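/- Let $W=\{W(h),\,h\in L^2(\mathbb R)\}$ be a Brownian field on a probability space $(\Omega,\mathcal F,P)$, i.e. a centered Gaussian family with $E[W(g)W(h)]=\langle g,h\rangle_{L^2(\mathbb R)}$. For $q\ge 1$ let $I_q^W$ be the multiple Wiener integral of order $q$, i.e. the continuous linear map from the symmetric functions in $L^2(\mathbb R^q)$ to $L^2(\Omega)$ with $I_q^W(h^{\otimes q})=H_q(W(h))$ for $\|h\|=1$, where $H_q$ is the $q$-th (probabilists') Hermite polynomial. For $q\ge1$ and $H\in(\tfrac12,1)$ let $Z=\{Z_t^{q,H},\,t\ge 0\}$ be the Hermite process of order $q$ with self-similarity parameter $H$, $$Z_t^{q,H}=c(q,H)\int_{\mathbb R^q}\Big(\int_0^t\prod_{j=1}^q (s-\psi_j)_+^{H_0-\frac32}\,ds\Big)dW_{\psi_1}\cdots dW_{\psi_q},$$ $$c(q,H)=\sqrt{\frac{H(2H-1)}{q!\,\beta(H_0-\frac12,\,2-2H_0)^q}},\qquad H_0=1+\frac{H-1}{q},$$ taken in a version with almost surely continuous sample paths, and put $Z_T^{q,H,*}=\sup_{0\le s\le T}|Z_s^{q,H}|$.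 **Theorem 3.1.** Let $T>0$ and $p>0$, and suppose that $E[(Z_1^{q,H,*})^p]<\infty$. Then $E[(Z_T^{q,H,*})^p]<\infty$ and $$E[(Z_T^{q,H,*})^p]=K(p,q,H)\,T^{pH},\qquad K(p,q,H)=E[(Z_1^{q,H,*})^p],$$ where the constant $K(p,q,H)$ depends only on $p$, $q$ and $H$ (not on $T$, the probability space, the Brownian field or the continuous version). -/

import Mathlib

open MeasureTheory ProbabilityTheory
open scoped NNReal ENNReal

noncomputable section

/-- The real Hilbert space `L²(ℝ)`. -/
abbrev L2R : Type := Lp ℝ 2 (volume : Measure ℝ)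

/-- A Brownian field (isonormal process) over `L²(ℝ)`: a centered Gaussian family
`W = {W(h), h ∈ L²(ℝ)}` with `E[W(g) W(h)] = ⟨g, h⟩`. -/
structure IsBrownianField {Ω : Type*} [MeasurableSpace Ω] (P : Measure Ω)
    (W : L2R → Ω → ℝ) : Prop where
  gaussian : IsGaussianProcess W P
  centered : ∀ h : L2R, ∫ ω, W h ω ∂P = 0
  covariance : ∀ g h : L2R, ∫ ω, W g ω * W h ω ∂P = inner ℝ g h

/-- The generating pairs `(h^{⊗q}, H_q(W(h)))`, with `‖h‖ = 1`, in `L²(ℝ^q) × L²(Ω)`. Here `H_q` is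
the probabilists' Hermite polynomial (`H_1 = x`, `H_2 = x² - 1`, `H_3 = x³ - 3x`, ...) and
`h^{⊗q}(ψ) = h(ψ_1) ⋯ h(ψ_q)`. -/
def wienerPairs {Ω : Type*} [MeasurableSpace Ω] (P : Measure Ω) (W : L2R → Ω → ℝ) (q : ℕ) :
    Set (Lp ℝ 2 (volume : Measure (Fin q → ℝ)) × Lp ℝ 2 P) :=
  {x | ∃ h : L2R, ‖h‖ = 1 ∧
    (x.1 =ᵐ[volume] fun ψ : Fin q → ℝ => ∏ j, h (ψ j)) ∧
    (x.2 =ᵐ[P] fun ω => Polynomial.aeval (W h ω) (Polynomial.hermite q))}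

/-- The graph of the multiple Wiener integral `I_q^W`: the continuous linear extension of
`h^{⊗q} ↦ H_q(W(h))`, `‖h‖ = 1`, i.e. the closed linear span of the generating pairs
in `L²(ℝ^q) × L²(Ω)`. For a Brownian field `W`, the assignment is `√(q!)` times an isometry on the
span of the tensors `h^{⊗q}`, which is dense in the symmetric functions of `L²(ℝ^q)`, so this closed
subspace is exactly the graph of `I_q^W` on the symmetric functions of `L²(ℝ^q)`. -/
def multipleWienerGraph {Ω : Type*} [MeasurableSpace Ω] (P : Measure Ω) (W : L2R → Ω → ℝ) (q : ℕ) :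
    Submodule ℝ (Lp ℝ 2 (volume : Measure (Fin q → ℝ)) × Lp ℝ 2 P) :=
  (Submodule.span ℝ (wienerPairs P W q)).topologicalClosure

/-- `Y` is (a version of) the multiple Wiener integral
`I_q^W(f) = ∫_{ℝ^q} f(ψ_1, …, ψ_q) dW_{ψ_1} ⋯ dW_{ψ_q}`. -/
def IsMultipleWienerIntegral {Ω : Type*} [MeasurableSpace Ω] (P : Measure Ω) (W : L2R → Ω → ℝ)
    (q : ℕ) (f : (Fin q → ℝ) → ℝ) (Y : Ω → ℝ) : Prop :=
  ∃ x ∈ multipleWienerGraph P W q, x.1 =ᵐ[volume] f ∧ x.2 =ᵐ[P] Y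

/-- `x_+^a`, which vanishes for `x ≤ 0`. -/
def posPow (x a : ℝ) : ℝ := if 0 < x then x ^ a else 0

/-- `H_0 = 1 + (H - 1) / q`. -/
def hermiteH0 (q : ℕ) (H : ℝ) : ℝ := 1 + (H - 1) / q

/-- The kernel `ψ ↦ ∫_0^t ∏_j (s - ψ_j)_+^{H_0 - 3/2} ds`. -/
def hermiteKernel (q : ℕ) (H t : ℝ) (ψ : Fin q → ℝ) : ℝ :=
  ∫ s in (0 : ℝ)..t, ∏ j, posPow (s - ψ j) (hermiteH0 q H - 3 / 2)

/-- The normalizing constant `√(H (2H - 1) / (q! β(H_0 - 1/2, 2 - 2 H_0)^q))`, where `β` is Euler's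
beta function. -/
def hermiteConst (q : ℕ) (H : ℝ) : ℝ :=
  √(H * (2 * H - 1) /
    (q.factorial * (ProbabilityTheory.beta (hermiteH0 q H - 1 / 2) (2 - 2 * hermiteH0 q H)) ^ q))

/-- `Z = {Z_t, t ≥ 0}` is the Hermite process of order `q` with self-similarity parameter `H`
built on the Brownian field `W`. As a multiple Wiener integral is a class of
almost surely equal random variables, this determines each `Z_t` up to almost sure equality. -/
structure IsHermiteProcess {Ω : Type*} [MeasurableSpace Ω] (P : Measure Ω) (W : L2R → Ω → ℝ)
    (q : ℕ) (H : ℝ) (Z : ℝ≥0 → Ω → ℝ) : Prop where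
  brownian : IsBrownianField P W
  eq_integral : ∀ t : ℝ≥0, ∃ Y : Ω → ℝ,
    IsMultipleWienerIntegral P W q (hermiteKernel q H t) Y ∧
    Z t =ᵐ[P] fun ω => hermiteConst q H * Y ω

/-- The running maximum `Z_T^* = sup_{0 ≤ s ≤ T} |Z_s|`. -/
def runningSup {Ω : Type*} (Z : ℝ≥0 → Ω → ℝ) (T : ℝ≥0) (ω : Ω) : ℝ :=
  sSup ((fun s : ℝ≥0 => |Z s ω|) '' Set.Icc 0 T)

end

/-! The identity follows from self-similarity together with uniqueness in law. Substituting s = Tt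
in each path turns Z_T^* into T^H times the running supremum over [0,1] of t ↦ T^{-H} Z_{Tt}. It
remains to see that the latter supremum has the law of Z_1^*.

Self-similarity (`IsHermiteProcess.exists_scaling`): a unitary dilation of L²(ℝ) carries W to
another Brownian field, and the homogeneity of the kernel makes T^{-H} Z_{T·} a Hermite process over
that field.

Uniqueness in law (`IsHermiteProcess.identDistrib_runningSup`): E[H_q(W(h)) H_q(W(k))] = q! ⟨h,k⟩^q
by Gaussian integration by parts, so the multiple integral is √(q!) times an isometry. An integral
is thus an L² limit of polynomials in finitely many W(h), whose joint law is fixed by inner products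
(`map_snd_eq_of_fst_eq`). The Cramér–Wold device gives joint laws, and path continuity gives the
supremum. Applied across probability spaces, the same uniqueness makes K well defined. -/

/-! ### Polynomials in variables with all moments -/

section Moments

variable {Ω : Type*} [MeasurableSpace Ω] {P : Measure Ω}

lemma memLp_mul_of_forall_memLp {f g : Ω → ℝ} (hf : ∀ r : ℝ≥0∞, r ≠ ∞ → MemLp f r P)
    (hg : ∀ r : ℝ≥0∞, r ≠ ∞ → MemLp g r P) (r : ℝ≥0∞) (hr : r ≠ ∞) :
    MemLp (fun ω => f ω * g ω) r P := by
  have : ENNReal.HolderTriple (2 * r) (2 * r) r := by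
    constructor
    rw [ENNReal.mul_inv (by simp) (by simp), ← add_mul, ENNReal.inv_two_add_inv_two, one_mul]
  have h2 : 2 * r ≠ ∞ := ENNReal.mul_ne_top (by simp) hr
  exact (hg _ h2).mul (hf _ h2)

lemma memLp_polynomial_eval [IsFiniteMeasure P] {f : Ω → ℝ}
    (hf : ∀ r : ℝ≥0∞, r ≠ ∞ → MemLp f r P) (p : Polynomial ℝ) :
    ∀ r : ℝ≥0∞, r ≠ ∞ → MemLp (fun ω => p.eval (f ω)) r P := by
  induction p using Polynomial.induction_on' with
  | add p q hp hq =>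
    intro r hr
    simp only [Polynomial.eval_add]
    exact (hp r hr).add (hq r hr)
  | monomial n a =>
    have hpow : ∀ r : ℝ≥0∞, r ≠ ∞ → MemLp (fun ω => f ω ^ n) r P := by
      induction n with
      | zero => intro r _; simpa using memLp_const (1 : ℝ)
      | succ n ih =>
        intro r hr
        simpa only [pow_succ] using memLp_mul_of_forall_memLp ih hf r hr
    intro r hr
    simpa only [Polynomial.eval_monomial] using (hpow r hr).const_mul a

end Moments

/-! ### Gaussian integration by parts and Hermite polynomials -/

section Stein

open Polynomial

lemma memLp_polynomial_eval_gaussianReal (p : ℝ[X]) (r : ℝ≥0∞) (hr : r ≠ ∞) :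
    MemLp (fun x => p.eval x) r (gaussianReal 0 1) :=
  memLp_polynomial_eval (f := fun x => x)
    (fun r hr => by
      lift r to ℝ≥0 using hr
      exact memLp_id_gaussianReal r) p r hr

lemma integrable_polynomial_eval_gaussianReal (p : ℝ[X]) :
    Integrable (fun x => p.eval x) (gaussianReal 0 1) :=
  (memLp_polynomial_eval_gaussianReal p 1 (by simp)).integrable le_rfl

lemma hasDerivAt_gaussianPDFReal_zero_one (x : ℝ) :
    HasDerivAt (gaussianPDFReal 0 1) (-x * gaussianPDFReal 0 1 x) x := by
  have h : HasDerivAt (fun x : ℝ => -(x - 0) ^ 2 / (2 * ((1 : ℝ≥0) : ℝ))) (-x) x := by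
    have := ((((hasDerivAt_id' x).sub_const 0).fun_pow 2).fun_neg).div_const (2 * ((1 : ℝ≥0) : ℝ))
    refine this.congr_deriv ?_
    simp
    ring
  have := (h.exp).const_mul ((√(2 * Real.pi * ((1 : ℝ≥0) : ℝ)))⁻¹)
  rw [gaussianPDFReal_def]
  refine this.congr_deriv ?_
  ring

lemma integrable_polynomial_eval_mul_gaussianPDFReal (p : ℝ[X]) :
    Integrable (fun x => p.eval x * gaussianPDFReal 0 1 x) := by
  have h := integrable_polynomial_eval_gaussianReal p
  rw [gaussianReal_of_var_ne_zero 0 one_ne_zero,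
    integrable_withDensity_iff (measurable_gaussianPDF 0 1)
      (ae_of_all _ fun x => by simp [gaussianPDF])] at h
  simpa [toReal_gaussianPDF] using h

/-- **Stein's identity** for polynomials and the standard Gaussian measure. -/
lemma integral_mul_polynomial_eval_gaussianReal (p : ℝ[X]) :
    ∫ x, x * p.eval x ∂gaussianReal 0 1 = ∫ x, (derivative p).eval x ∂gaussianReal 0 1 := by
  rw [integral_gaussianReal_eq_integral_smul one_ne_zero,
    integral_gaussianReal_eq_integral_smul one_ne_zero]
  have h := integral_mul_deriv_eq_deriv_mul_of_integrable
    (u := fun x => p.eval x) (v := gaussianPDFReal 0 1)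
    (u' := fun x => (derivative p).eval x) (v' := fun x => -x * gaussianPDFReal 0 1 x)
    (fun x _ => p.hasDerivAt x) (fun x _ => hasDerivAt_gaussianPDFReal_zero_one x)
    (by
      refine (integrable_polynomial_eval_mul_gaussianPDFReal (-X * p)).congr (ae_of_all _ fun x => ?_)
      simp
      ring)
    (integrable_polynomial_eval_mul_gaussianPDFReal _)
    (integrable_polynomial_eval_mul_gaussianPDFReal _)
  simp only [smul_eq_mul]
  have h1 : ∀ x, gaussianPDFReal 0 1 x * (x * p.eval x)
      = -(p.eval x * (-x * gaussianPDFReal 0 1 x)) := fun x => by ring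
  have h2 : ∀ x, gaussianPDFReal 0 1 x * (derivative p).eval x
      = (derivative p).eval x * gaussianPDFReal 0 1 x := fun x => by ring
  simp only [h1, h2, integral_neg, h, neg_neg]

variable {Ω : Type*} [MeasurableSpace Ω] {P : Measure Ω}

lemma HasGaussianLaw.map_eq_gaussianReal_zero_one {X : Ω → ℝ} (hX : HasGaussianLaw X P)
    (h0 : ∫ ω, X ω ∂P = 0) (h1 : ∫ ω, X ω * X ω ∂P = 1) : P.map X = gaussianReal 0 1 := by
  have := hX.isProbabilityMeasure
  rw [hX.map_eq_gaussianReal, h0, variance_of_integral_eq_zero hX.aemeasurable h0]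
  simp [pow_two, h1]

/-- Stein's identity for polynomials of two jointly Gaussian standard variables. -/
lemma integral_mul_eval_mul_eval {X Y : Ω → ℝ} {ρ : ℝ}
    (hXY : HasGaussianLaw (fun ω => (X ω, Y ω)) P) (hX0 : ∫ ω, X ω ∂P = 0)
    (hX1 : ∫ ω, X ω * X ω ∂P = 1) (hρ : ∫ ω, X ω * Y ω ∂P = ρ) (F G : ℝ[X]) :
    ∫ ω, X ω * F.eval (X ω) * G.eval (Y ω) ∂P
      = ∫ ω, (derivative F).eval (X ω) * G.eval (Y ω) ∂P
        + ρ * ∫ ω, F.eval (X ω) * (derivative G).eval (Y ω) ∂P := by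
  have := hXY.isProbabilityMeasure
  -- The residual Y - ρX is uncorrelated with X because E[X²] = 1, hence independent of X by joint
  -- Gaussianity. Fubini then allows Z = z to be frozen and the one-variable identity to be applied
  -- to x ↦ F(x) G(ρx + z); the chain rule produces the factor ρ.
  set Z : Ω → ℝ := fun ω => Y ω - ρ * X ω with hZ
  have hXZ : HasGaussianLaw (fun ω => (X ω, Z ω)) P := by
    have := hXY.map_fun ((ContinuousLinearMap.fst ℝ ℝ ℝ).prod
      (ContinuousLinearMap.snd ℝ ℝ ℝ - ρ • ContinuousLinearMap.fst ℝ ℝ ℝ))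
    simpa [hZ] using this
  have hXm : ∀ r : ℝ≥0∞, r ≠ ∞ → MemLp X r P := fun r hr => hXY.fst.memLp hr
  have hYm : ∀ r : ℝ≥0∞, r ≠ ∞ → MemLp Y r P := fun r hr => hXY.snd.memLp hr
  have hcov : cov[X, Z; P] = 0 := by
    rw [covariance_eq_sub (hXm 2 (by simp)) (hXZ.snd.memLp (by simp)), hX0]
    have e : ∀ ω, (X * Z) ω = X ω * Y ω - ρ * (X ω * X ω) := fun ω => by
      simp [hZ]; ring
    have i1 : Integrable (fun ω => X ω * Y ω) P :=
      (memLp_mul_of_forall_memLp hXm hYm 1 (by simp)).integrable le_rfl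
    have i2 : Integrable (fun ω => X ω * X ω) P :=
      (memLp_mul_of_forall_memLp hXm hXm 1 (by simp)).integrable le_rfl
    simp only [e]
    rw [integral_sub i1 (i2.const_mul ρ), integral_const_mul, hX1, hρ]
    simp
  have hind : IndepFun X Z P := hXZ.indepFun_of_covariance_eq_zero hcov
  have hlaw := HasGaussianLaw.map_eq_gaussianReal_zero_one hXY.fst hX0 hX1
  have hprod : P.map (fun ω => (X ω, Z ω)) = (gaussianReal 0 1).prod (P.map Z) := by
    rw [(indepFun_iff_map_prod_eq_prod_map_map hXZ.fst.aemeasurable hXZ.snd.aemeasurable).1 hind,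
      hlaw]
  have hYe : ∀ ω, Y ω = ρ * X ω + Z ω := fun ω => by simp [hZ]
  have hZa := hXZ.snd.aemeasurable
  have : IsProbabilityMeasure (P.map Z) := Measure.isProbabilityMeasure_map hZa
  have key : ∀ A B : ℝ[X], Integrable (fun ω => A.eval (X ω) * B.eval (Y ω)) P ∧
      Integrable (fun z => ∫ x, A.eval x * B.eval (ρ * x + z) ∂gaussianReal 0 1) (P.map Z) ∧
      ∫ ω, A.eval (X ω) * B.eval (Y ω) ∂P
        = ∫ z, ∫ x, A.eval x * B.eval (ρ * x + z) ∂gaussianReal 0 1 ∂(P.map Z) := by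
    intro A B
    have i0 : Integrable (fun ω => A.eval (X ω) * B.eval (Y ω)) P :=
      (memLp_mul_of_forall_memLp (memLp_polynomial_eval hXm A) (memLp_polynomial_eval hYm B) 1
        (by simp)).integrable le_rfl
    have hm : Measurable (fun u : ℝ × ℝ => A.eval u.1 * B.eval (ρ * u.1 + u.2)) := by
      have hA := A.continuous.measurable
      have hB := B.continuous.measurable
      fun_prop
    have i1 : Integrable (fun u : ℝ × ℝ => A.eval u.1 * B.eval (ρ * u.1 + u.2))
        ((gaussianReal 0 1).prod (P.map Z)) := by
      rw [← hprod, integrable_map_measure hm.aestronglyMeasurable hXZ.aemeasurable]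
      refine i0.congr (ae_of_all _ fun ω => ?_)
      simp [hYe ω]
    refine ⟨i0, i1.integral_prod_right, ?_⟩
    rw [← integral_prod_symm _ i1, ← hprod,
      integral_map hXZ.aemeasurable hm.aestronglyMeasurable]
    simp [hYe]
  have k1 := key (Polynomial.X * F) G
  have k2 := key (derivative F) G
  have k3 := key F (derivative G)
  simp only [eval_mul, eval_X] at k1
  rw [k1.2.2, k2.2.2, k3.2.2, ← integral_const_mul, ← integral_add k2.2.1 (k3.2.1.const_mul ρ)]
  refine integral_congr_ae (ae_of_all _ fun z => ?_)
  have hs := integral_mul_polynomial_eval_gaussianReal (F * G.comp (C ρ * Polynomial.X + C z))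
  simp only [eval_mul, eval_comp, eval_add, eval_C, eval_X, derivative_mul, derivative_comp,
    derivative_add, derivative_C, derivative_X] at hs
  simp only [mul_assoc, hs]
  have j1 : Integrable (fun x => (derivative F).eval x * G.eval (ρ * x + z))
      (gaussianReal 0 1) := 
    (integrable_polynomial_eval_gaussianReal
      (derivative F * G.comp (C ρ * Polynomial.X + C z))).congr (ae_of_all _ fun x => by simp)
  have j2 : Integrable (fun x => F.eval x * (derivative G).eval (ρ * x + z))
      (gaussianReal 0 1) := 
    (integrable_polynomial_eval_gaussianReal
      (F * (derivative G).comp (C ρ * Polynomial.X + C z))).congr (ae_of_all _ fun x => by simp)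
  rw [← integral_const_mul, ← integral_add j1 (j2.const_mul ρ)]
  refine integral_congr_ae (ae_of_all _ fun x => ?_)
  simp
  ring

lemma derivative_hermite_succ (n : ℕ) :
    derivative (hermite (n + 1)) = (n + 1 : ℤ[X]) * hermite n := by
  induction n with
  | zero => simp
  | succ n ih =>
    rw [hermite_succ (n + 1), derivative_sub, derivative_mul, ih, derivative_X, derivative_mul,
      hermite_succ n]
    have : derivative (n + 1 : ℤ[X]) = 0 := by
      rw [derivative_add, derivative_natCast, derivative_one, add_zero]
    rw [this]
    push_cast
    ring

/-- Induction through H_{n+1} = x H_n - H_n'. Stein's identity cancels the H_n' term and leaves ρ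
E[H_n(X) H_{n+1}'(Y)], where H_{n+1}' = (n+1) H_n. -/
lemma integral_hermite_mul_hermite {X Y : Ω → ℝ} {ρ : ℝ}
    (hXY : HasGaussianLaw (fun ω => (X ω, Y ω)) P) (hX0 : ∫ ω, X ω ∂P = 0)
    (hX1 : ∫ ω, X ω * X ω ∂P = 1) (hρ : ∫ ω, X ω * Y ω ∂P = ρ) (n : ℕ) :
    ∫ ω, aeval (X ω) (hermite n) * aeval (Y ω) (hermite n) ∂P = n.factorial * ρ ^ n := by
  have := hXY.isProbabilityMeasure
  induction n with
  | zero => simp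
  | succ n ih =>
    have hXm : ∀ r : ℝ≥0∞, r ≠ ∞ → MemLp X r P := fun r hr => hXY.fst.memLp hr
    have hYm : ∀ r : ℝ≥0∞, r ≠ ∞ → MemLp Y r P := fun r hr => hXY.snd.memLp hr
    set h : ℕ → ℝ[X] := fun k => (hermite k).map (Int.castRingHom ℝ) with hh
    have hev : ∀ (k : ℕ) (x : ℝ), aeval x (hermite k) = (h k).eval x := fun k x => by
      rw [hh, aeval_def, eval_map]; rfl
    have hsucc : h (n + 1) = Polynomial.X * h n - derivative (h n) := by
      simp [hh, hermite_succ, derivative_map]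
    have hder : derivative (h (n + 1)) = C (n + 1 : ℝ) * h n := by
      simp only [hh, derivative_map, derivative_hermite_succ, Polynomial.map_mul]
      simp
    have hint : ∀ A B : ℝ[X], Integrable (fun ω => A.eval (X ω) * B.eval (Y ω)) P := fun A B =>
      (memLp_mul_of_forall_memLp (memLp_polynomial_eval hXm A) (memLp_polynomial_eval hYm B) 1
        (by simp)).integrable le_rfl
    have hs := integral_mul_eval_mul_eval hXY hX0 hX1 hρ (h n) (h (n + 1))
    simp only [hev] at ih ⊢
    have e : ∀ ω, (h (n + 1)).eval (X ω) * (h (n + 1)).eval (Y ω)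
        = X ω * (h n).eval (X ω) * (h (n + 1)).eval (Y ω)
          - (derivative (h n)).eval (X ω) * (h (n + 1)).eval (Y ω) := fun ω => by
      nth_rw 1 [hsucc]
      simp
      ring
    simp only [e]
    have i1 := hint (Polynomial.X * h n) (h (n + 1))
    simp only [eval_mul, eval_X] at i1
    rw [integral_sub i1 (hint _ _), hs, add_sub_cancel_left, hder]
    simp only [eval_mul, eval_C, mul_left_comm _ (n + 1 : ℝ), integral_const_mul, ih]
    rw [Nat.factorial_succ]
    push_cast
    ring

end Stein

/-! ### The isometry property -/

section Isometry

variable {Ω : Type*} [MeasurableSpace Ω] {P : Measure Ω} {W : L2R → Ω → ℝ} {q : ℕ}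

lemma inner_tensor {f g : Lp ℝ 2 (volume : Measure (Fin q → ℝ))} {h k : L2R}
    (hf : f =ᵐ[volume] fun ψ => ∏ j, h (ψ j)) (hg : g =ᵐ[volume] fun ψ => ∏ j, k (ψ j)) :
    inner ℝ f g = (inner ℝ h k : ℝ) ^ q := by
  have e : ∀ᵐ ψ : Fin q → ℝ, inner ℝ (f ψ) (g ψ) = ∏ j, inner ℝ (h (ψ j)) (k (ψ j)) := by
    filter_upwards [hf, hg] with ψ h1 h2
    simp [h1, h2, Finset.prod_mul_distrib]
  rw [L2.inner_def, integral_congr_ae e,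
    integral_fintype_prod_volume_eq_prod (fun _ : Fin q => fun x => inner ℝ (h x) (k x))]
  simp [L2.inner_def]

lemma inner_hermite (hW : IsBrownianField P W) {f g : Lp ℝ 2 P} {h k : L2R} (hh : ‖h‖ = 1)
    (hf : f =ᵐ[P] fun ω => Polynomial.aeval (W h ω) (Polynomial.hermite q))
    (hg : g =ᵐ[P] fun ω => Polynomial.aeval (W k ω) (Polynomial.hermite q)) :
    inner ℝ f g = q.factorial * (inner ℝ h k : ℝ) ^ q := by
  have e : ∀ᵐ ω ∂P, inner ℝ (f ω) (g ω) = Polynomial.aeval (W h ω) (Polynomial.hermite q)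
      * Polynomial.aeval (W k ω) (Polynomial.hermite q) := by
    filter_upwards [hf, hg] with ω h1 h2
    simp [h1, h2, mul_comm]
  rw [L2.inner_def, integral_congr_ae e]
  refine integral_hermite_mul_hermite hW.gaussian.hasGaussianLaw_prodMk (hW.centered h) ?_
    (hW.covariance h k) q
  rw [hW.covariance, real_inner_self_eq_norm_sq, hh, one_pow]

/-- By bilinearity only generators matter, and for them the two inner products are q! ⟨h,k⟩^q and
⟨h,k⟩^q. -/
lemma inner_snd_of_mem_span (hW : IsBrownianField P W)
    {x y : Lp ℝ 2 (volume : Measure (Fin q → ℝ)) × Lp ℝ 2 P}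
    (hx : x ∈ Submodule.span ℝ (wienerPairs P W q))
    (hy : y ∈ Submodule.span ℝ (wienerPairs P W q)) :
    inner ℝ x.2 y.2 = q.factorial * (inner ℝ x.1 y.1 : ℝ) := by
  induction hx, hy using Submodule.span_induction₂ with
  | mem_mem x y hx hy =>
    obtain ⟨h, hh, hx1, hx2⟩ := hx
    obtain ⟨k, hk, hy1, hy2⟩ := hy
    rw [inner_hermite hW hh hx2 hy2, inner_tensor hx1 hy1]
  | zero_left y hy => simp
  | zero_right x hx => simp
  | add_left x y z hx hy hz h1 h2 => simp [inner_add_left, h1, h2, mul_add]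
  | add_right x y z hx hy hz h1 h2 => simp [inner_add_right, h1, h2, mul_add]
  | smul_left r x y hx hy h => simp [inner_smul_left, h, mul_left_comm]
  | smul_right r x y hx hy h => simp [inner_smul_right, h, mul_left_comm]

/-- The multiple Wiener integral is `√(q!)` times an isometry. -/
lemma norm_snd_sq_of_mem_multipleWienerGraph (hW : IsBrownianField P W)
    {x : Lp ℝ 2 (volume : Measure (Fin q → ℝ)) × Lp ℝ 2 P}
    (hx : x ∈ multipleWienerGraph P W q) : ‖x.2‖ ^ 2 = q.factorial * ‖x.1‖ ^ 2 := by
  have hc : IsClosed {x : Lp ℝ 2 (volume : Measure (Fin q → ℝ)) × Lp ℝ 2 P |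
      ‖x.2‖ ^ 2 = q.factorial * ‖x.1‖ ^ 2} :=
    isClosed_eq (by fun_prop) (by fun_prop)
  refine closure_minimal (fun y hy => ?_) hc hx
  have := inner_snd_of_mem_span hW hy hy
  simpa only [real_inner_self_eq_norm_sq, Set.mem_ofPred_eq] using this

end Isometry

/-! ### Finite combinations of Hermite polynomials of the field -/

section HermiteComb

variable {Ω : Type*}

/-- A linear combination of Hermite polynomials of the field. -/
noncomputable def hermiteComb (W : L2R → Ω → ℝ) (q : ℕ) (c : L2R →₀ ℝ) (ω : Ω) : ℝ :=
  c.sum fun h a => a * Polynomial.aeval (W h ω) (Polynomial.hermite q)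

lemma hermiteComb_single (W : L2R → Ω → ℝ) (q : ℕ) (h : L2R) (ω : Ω) :
    hermiteComb W q (Finsupp.single h 1) ω = Polynomial.aeval (W h ω) (Polynomial.hermite q) := by
  simp [hermiteComb]

lemma hermiteComb_zero (W : L2R → Ω → ℝ) (q : ℕ) : hermiteComb W q 0 = 0 := by
  ext ω
  simp [hermiteComb]

lemma hermiteComb_add (W : L2R → Ω → ℝ) (q : ℕ) (c d : L2R →₀ ℝ) :
    hermiteComb W q (c + d) = hermiteComb W q c + hermiteComb W q d :=
  funext fun _ => Finsupp.sum_add_index' (by simp) (by intros; ring)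

lemma hermiteComb_smul (W : L2R → Ω → ℝ) (q : ℕ) (a : ℝ) (c : L2R →₀ ℝ) :
    hermiteComb W q (a • c) = a • hermiteComb W q c := by
  ext ω
  rw [Pi.smul_apply, hermiteComb, hermiteComb, Finsupp.sum_smul_index (by simp), smul_eq_mul,
    Finsupp.mul_sum]
  simp only [mul_assoc]

/-- The outer function does not involve W, so the law is the image of a finite-dimensional marginal
of the field. -/
lemma hermiteComb_eq_comp (W : L2R → Ω → ℝ) (q : ℕ) (c : L2R →₀ ℝ) : hermiteComb W q c
    = (fun w : c.support → ℝ =>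
        ∑ h : c.support, c h * Polynomial.aeval (w h) (Polynomial.hermite q)) ∘
      (fun ω => c.support.restrict (W · ω)) := by
  ext ω
  simp only [hermiteComb, Finsupp.sum, Function.comp_apply, Finset.restrict]
  exact (Finset.sum_coe_sort c.support
    (fun h => c h * Polynomial.aeval (W h ω) (Polynomial.hermite q))).symm

end HermiteComb

/-! ### Laws of multiple Wiener integrals -/

section Law

variable {Ω Ω' : Type*} [MeasurableSpace Ω] [MeasurableSpace Ω'] {P : Measure Ω} {P' : Measure Ω'}
  {W : L2R → Ω → ℝ} {W' : L2R → Ω' → ℝ} {q : ℕ}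

lemma IsBrownianField.variance_sum (hW : IsBrownianField P W) (I : Finset L2R) (c : I → ℝ) :
    Var[fun ω => ∑ i, c i * W i ω; P] = ‖∑ i, c i • (i : L2R)‖ ^ 2 := by
  have := hW.gaussian.isProbabilityMeasure
  have hm : ∀ h, MemLp (W h) 2 P := fun h => (hW.gaussian.hasGaussianLaw_eval h).memLp_two
  have hi : ∀ g h : L2R, Integrable (fun ω => W g ω * W h ω) P := fun g h =>
    (hm h).integrable_mul (hm g) |>.congr (ae_of_all _ fun ω => mul_comm _ _)
  have hmean : ∫ ω, ∑ i, c i * W i ω ∂P = 0 := by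
    rw [integral_finsetSum _ fun (i : I) _ => ((hm i).integrable (by simp)).const_mul _]
    simp [integral_const_mul, hW.centered]
  rw [variance_of_integral_eq_zero _ hmean, ← real_inner_self_eq_norm_sq]
  · have e : ∀ ω, (∑ i, c i * W i ω) ^ 2 = ∑ i, ∑ j, c i * c j * (W i ω * W j ω) := fun ω => by
      rw [pow_two, Finset.sum_mul_sum]
      exact Finset.sum_congr rfl fun i _ => Finset.sum_congr rfl fun j _ => by ring
    simp only [e]
    rw [integral_finsetSum _ fun (i : I) _ =>
      integrable_finsetSum _ fun (j : I) _ => (hi i j).const_mul _]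
    rw [sum_inner]
    simp only [inner_sum, inner_smul_left, inner_smul_right]
    refine Finset.sum_congr rfl fun (i : I) _ => ?_
    rw [integral_finsetSum _ fun (j : I) _ => (hi i j).const_mul _]
    refine Finset.sum_congr rfl fun (j : I) _ => ?_
    rw [integral_const_mul, hW.covariance]
    simp
    ring
  · exact Finset.aemeasurable_fun_sum _ fun i _ => (hm i).aestronglyMeasurable.aemeasurable.const_mul _

-- The right-hand side involves only the geometry of L²(ℝ), so the marginals are the same for all
-- Brownian fields.
open Classical in
lemma IsBrownianField.charFunDual_map_restrict (hW : IsBrownianField P W) (I : Finset L2R)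
    (L : StrongDual ℝ (I → ℝ)) :
    charFunDual (P.map (fun ω => I.restrict (W · ω))) L
      = Complex.exp (-((‖∑ i, L (Pi.single i 1) • (i : L2R)‖ ^ 2 : ℝ) : ℂ) / 2) := by
  have := hW.gaussian.isProbabilityMeasure
  have hL : ∀ ω, L (I.restrict (W · ω)) = ∑ i, L (Pi.single i 1) * W i ω := fun ω => by
    conv_lhs => rw [← Finset.univ_sum_single (I.restrict (W · ω)), map_sum]
    refine Finset.sum_congr rfl fun i _ => ?_
    have : (Pi.single i (I.restrict (W · ω) i) : I → ℝ) = W i ω • Pi.single i 1 := by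
      rw [← Pi.single_smul]; simp
    rw [this, map_smul, smul_eq_mul, mul_comm]
  have hmean : ∫ ω, ∑ i : I, L (Pi.single i 1) * W i ω ∂P = 0 := by
    rw [integral_finsetSum _ fun (i : I) _ =>
      ((hW.gaussian.hasGaussianLaw_eval i).memLp_two.integrable (by simp)).const_mul _]
    simp [integral_const_mul, hW.centered]
  rw [(hW.gaussian.hasGaussianLaw I).charFunDual_map_eq_fun]
  simp only [hL, hmean, hW.variance_sum]
  congr 1
  simp
  ring

lemma IsBrownianField.map_restrict_eq (hW : IsBrownianField P W) (hW' : IsBrownianField P' W')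
    (I : Finset L2R) :
    P.map (fun ω => I.restrict (W · ω)) = P'.map (fun ω => I.restrict (W' · ω)) := by
  have := hW.gaussian.isProbabilityMeasure
  have := hW'.gaussian.isProbabilityMeasure
  have := Measure.isProbabilityMeasure_map (hW.gaussian.hasGaussianLaw I).aemeasurable
  have := Measure.isProbabilityMeasure_map (hW'.gaussian.hasGaussianLaw I).aemeasurable
  refine Measure.ext_of_charFunDual ?_
  ext L
  rw [hW.charFunDual_map_restrict, hW'.charFunDual_map_restrict]

lemma memLp_hermite (hW : IsBrownianField P W) (h : L2R) :
    MemLp (fun ω => Polynomial.aeval (W h ω) (Polynomial.hermite q)) 2 P := by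
  have := hW.gaussian.isProbabilityMeasure
  have := memLp_polynomial_eval
    (fun r hr => (hW.gaussian.hasGaussianLaw_eval h).memLp hr)
    ((Polynomial.hermite q).map (Int.castRingHom ℝ)) 2 (by simp)
  simpa only [Polynomial.eval_map, Polynomial.aeval_def, algebraMap_int_eq] using this

/-- Transfers an approximation from one field to another: the same coefficients serve both, and the
kernel is unchanged. -/
lemma exists_hermiteComb_of_mem_span (hW' : IsBrownianField P' W')
    {x : Lp ℝ 2 (volume : Measure (Fin q → ℝ)) × Lp ℝ 2 P}
    (hx : x ∈ Submodule.span ℝ (wienerPairs P W q)) :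
    ∃ c : L2R →₀ ℝ, x.2 =ᵐ[P] hermiteComb W q c ∧
      ∃ x' ∈ Submodule.span ℝ (wienerPairs P' W' q), x'.1 = x.1 ∧
        x'.2 =ᵐ[P'] hermiteComb W' q c := by
  induction hx using Submodule.span_induction with
  | mem x hx =>
    obtain ⟨h, hh, h1, h2⟩ := hx
    refine ⟨Finsupp.single h 1, h2.trans (ae_of_all _ fun ω => ?_),
      (x.1, (memLp_hermite hW' h).toLp _),
      Submodule.subset_span ⟨h, hh, h1, (memLp_hermite hW' h).coeFn_toLp⟩, rfl,
      (memLp_hermite hW' h).coeFn_toLp.trans (ae_of_all _ fun ω => ?_)⟩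
    · exact (hermiteComb_single W q h ω).symm
    · exact (hermiteComb_single W' q h ω).symm
  | zero =>
    refine ⟨0, ?_, 0, Submodule.zero_mem _, rfl, ?_⟩
    · rw [hermiteComb_zero]
      exact Lp.coeFn_zero ℝ 2 P
    · rw [hermiteComb_zero]
      exact Lp.coeFn_zero ℝ 2 P'
  | add x y hx hy ihx ihy =>
    obtain ⟨c, hc, x', hx', h1, h2⟩ := ihx
    obtain ⟨d, hd, y', hy', h3, h4⟩ := ihy
    refine ⟨c + d, ?_, x' + y', Submodule.add_mem _ hx' hy', by simp [h1, h3], ?_⟩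
    · rw [hermiteComb_add]
      exact (Lp.coeFn_add x.2 y.2).trans (hc.add hd)
    · rw [hermiteComb_add]
      exact (Lp.coeFn_add x'.2 y'.2).trans (h2.add h4)
  | smul a x hx ih =>
    obtain ⟨c, hc, x', hx', h1, h2⟩ := ih
    refine ⟨a • c, ?_, a • x', Submodule.smul_mem _ _ hx', by simp [h1], ?_⟩
    · rw [hermiteComb_smul]
      exact (Lp.coeFn_smul a x.2).trans (hc.const_smul a)
    · rw [hermiteComb_smul]
      exact (Lp.coeFn_smul a x'.2).trans (h2.const_smul a)

lemma map_hermiteComb_eq (hW : IsBrownianField P W) (hW' : IsBrownianField P' W')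
    (c : L2R →₀ ℝ) : P.map (hermiteComb W q c) = P'.map (hermiteComb W' q c) := by
  have hm : Measurable (fun w : c.support → ℝ =>
      ∑ h : c.support, c h * Polynomial.aeval (w h) (Polynomial.hermite q)) := by
    refine Finset.measurable_fun_sum _ fun h _ => Measurable.const_mul ?_ _
    exact ((Polynomial.hermite q).continuous_aeval.measurable).comp (measurable_pi_apply h)
  rw [hermiteComb_eq_comp W, hermiteComb_eq_comp W',
    ← AEMeasurable.map_map_of_aemeasurable hm.aemeasurable
      (hW.gaussian.hasGaussianLaw _).aemeasurable,
    ← AEMeasurable.map_map_of_aemeasurable hm.aemeasurable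
      (hW'.gaussian.hasGaussianLaw _).aemeasurable,
    hW.map_restrict_eq hW']

/-- The law of a multiple Wiener integral depends only on its kernel. -/
lemma map_snd_eq_of_fst_eq (hW : IsBrownianField P W) (hW' : IsBrownianField P' W')
    {x : Lp ℝ 2 (volume : Measure (Fin q → ℝ)) × Lp ℝ 2 P}
    {x' : Lp ℝ 2 (volume : Measure (Fin q → ℝ)) × Lp ℝ 2 P'}
    (hx : x ∈ multipleWienerGraph P W q) (hx' : x' ∈ multipleWienerGraph P' W' q)
    (h : x.1 = x'.1) : P.map x.2 = P'.map x'.2 := by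
  have := hW.gaussian.isProbabilityMeasure
  have := hW'.gaussian.isProbabilityMeasure
  obtain ⟨u, hu, hux⟩ := mem_closure_iff_seq_limit.1 hx
  choose c hc u' hu' h1 h2 using fun n => exists_hermiteComb_of_mem_span hW' (hu n)
  -- The isometry over W' converts convergence of the common kernels into convergence in L²(P').
  have hux' : Filter.Tendsto (fun n => (u' n).2) Filter.atTop (nhds x'.2) := by
    rw [tendsto_iff_norm_sub_tendsto_zero]
    have e : ∀ n, ‖(u' n).2 - x'.2‖ = √(q.factorial * ‖(u n).1 - x.1‖ ^ 2) := fun n => by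
      have := norm_snd_sq_of_mem_multipleWienerGraph hW'
        (Submodule.sub_mem _ (Submodule.le_topologicalClosure _ (hu' n)) hx')
      rw [Prod.fst_sub, Prod.snd_sub, h1, ← h] at this
      rw [← this, Real.sqrt_sq (norm_nonneg _)]
    simp only [e]
    have h3 : Filter.Tendsto (fun n => (u n).1) Filter.atTop (nhds x.1) :=
      (continuous_fst.tendsto x).comp hux
    have h4 : Filter.Tendsto (fun n => √(q.factorial * ‖(u n).1 - x.1‖ ^ 2)) Filter.atTop
        (nhds (√(q.factorial * (0 : ℝ) ^ 2))) :=
      ((((tendsto_iff_norm_sub_tendsto_zero.1 h3).pow 2).const_mul _).sqrt)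
    simpa using h4
  have d1 := (tendstoInMeasure_of_tendsto_Lp ((continuous_snd.tendsto x).comp hux)
    ).tendstoInDistribution (fun n => (Lp.aestronglyMeasurable _).aemeasurable)
  have d2 := (tendstoInMeasure_of_tendsto_Lp hux').tendstoInDistribution
    (fun n => (Lp.aestronglyMeasurable _).aemeasurable)
  have heq : ∀ n, P.map (u n).2 = P'.map (u' n).2 := fun n => by
    rw [Measure.map_congr (hc n), Measure.map_congr (h2 n), map_hermiteComb_eq hW hW']
  -- Convergence in distribution sees only laws, so the sequence on Ω' also converges to the limit
  -- living on Ω.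
  have d3 : TendstoInDistribution (fun n => ((u' n).2 : Ω' → ℝ)) Filter.atTop (x.2 : Ω → ℝ)
      (fun _ => P') P := by
    refine ⟨d2.forall_aemeasurable, d1.aemeasurable_limit, ?_⟩
    simpa only [Function.comp_apply, heq] using d1.tendsto
  exact tendstoInDistribution_unique _ d3 d2

-- Cramér–Wold ingredient: a linear functional of several integrals is a single integral, of the
-- combined kernel.
open Classical in
lemma comp_snd_ae_eq_sum {ι : Type*} [Fintype ι] (L : StrongDual ℝ (ι → ℝ))
    (x : ι → Lp ℝ 2 (volume : Measure (Fin q → ℝ)) × Lp ℝ 2 P) :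
    (L ∘ fun ω i => (x i).2 ω) =ᵐ[P] (∑ i, L (Pi.single i 1) • x i).2 := by
  have h : ∀ᵐ ω ∂P, ∀ i, (L (Pi.single i 1) • (x i).2 : Lp ℝ 2 P) ω
      = L (Pi.single i 1) * (x i).2 ω :=
    ae_all_iff.2 fun i => Lp.coeFn_smul _ _
  rw [Prod.snd_sum]
  filter_upwards [Lp.coeFn_fun_finsetSum Finset.univ fun i => (L (Pi.single i 1) • x i).2, h]
    with ω h1 h2
  rw [h1, Function.comp_apply]
  conv_lhs => rw [← Finset.univ_sum_single (fun i => (x i).2 ω), map_sum]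
  refine Finset.sum_congr rfl fun i _ => ?_
  have : (Pi.single i ((x i).2 ω) : ι → ℝ) = (x i).2 ω • Pi.single i 1 := by
    rw [← Pi.single_smul]; simp
  rw [this, map_smul, smul_eq_mul, mul_comm, Prod.smul_snd, h2]

/-- The joint law of finitely many multiple Wiener integrals depends only on their kernels. -/
lemma map_pi_snd_eq_of_fst_eq {ι : Type*} [Fintype ι] (hW : IsBrownianField P W)
    (hW' : IsBrownianField P' W')
    {x : ι → Lp ℝ 2 (volume : Measure (Fin q → ℝ)) × Lp ℝ 2 P}
    {x' : ι → Lp ℝ 2 (volume : Measure (Fin q → ℝ)) × Lp ℝ 2 P'}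
    (hx : ∀ i, x i ∈ multipleWienerGraph P W q) (hx' : ∀ i, x' i ∈ multipleWienerGraph P' W' q)
    (h : ∀ i, (x i).1 = (x' i).1) :
    P.map (fun ω i => (x i).2 ω) = P'.map (fun ω i => (x' i).2 ω) := by
  classical
  have := hW.gaussian.isProbabilityMeasure
  have := hW'.gaussian.isProbabilityMeasure
  have m1 : AEMeasurable (fun ω i => (x i).2 ω) P :=
    aemeasurable_pi_lambda _ fun i => (Lp.aestronglyMeasurable _).aemeasurable
  have m2 : AEMeasurable (fun ω i => (x' i).2 ω) P' :=
    aemeasurable_pi_lambda _ fun i => (Lp.aestronglyMeasurable _).aemeasurable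
  have := Measure.isProbabilityMeasure_map m1
  have := Measure.isProbabilityMeasure_map m2
  refine Measure.ext_of_charFunDual ?_
  ext L
  rw [charFunDual_eq_charFun_map_one, charFunDual_eq_charFun_map_one,
    AEMeasurable.map_map_of_aemeasurable L.continuous.aemeasurable m1,
    AEMeasurable.map_map_of_aemeasurable L.continuous.aemeasurable m2]
  rw [Measure.map_congr (comp_snd_ae_eq_sum L x), Measure.map_congr (comp_snd_ae_eq_sum L x')]
  congr 1
  refine map_snd_eq_of_fst_eq hW hW'
    (Submodule.sum_mem _ fun i _ => Submodule.smul_mem _ _ (hx i))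
    (Submodule.sum_mem _ fun i _ => Submodule.smul_mem _ _ (hx' i)) ?_
  simp only [Prod.fst_sum, Prod.smul_fst, h]

end Law

/-! ### Law of the running supremum -/

lemma runningSup_eq_iSup_dense {Ω : Type*} {Z : ℝ≥0 → Ω → ℝ} {T : ℝ≥0}
    {S : Set (Set.Icc 0 T)} (hS : Dense S) {ω : Ω} (hω : Continuous fun t => Z t ω) :
    runningSup Z T ω = ⨆ s : S, |Z s ω| := by
  have hc : Continuous fun s : Set.Icc 0 T => |Z s ω| := by fun_prop
  rw [hS.ciSup' hc, runningSup, sSup_image']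

section RunningSupLaw

variable {Ω Ω' : Type*} [MeasurableSpace Ω] [MeasurableSpace Ω'] {P : Measure Ω} {P' : Measure Ω'}
  {W : L2R → Ω → ℝ} {W' : L2R → Ω' → ℝ} {q : ℕ} {H : ℝ} {Z : ℝ≥0 → Ω → ℝ} {Z' : ℝ≥0 → Ω' → ℝ}

lemma IsHermiteProcess.exists_mem_graph (hZ : IsHermiteProcess P W q H Z) (t : ℝ≥0) :
    ∃ x ∈ multipleWienerGraph P W q,
      (x.1 =ᵐ[volume] fun ψ => hermiteConst q H * hermiteKernel q H t ψ) ∧ x.2 =ᵐ[P] Z t := by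
  obtain ⟨Y, ⟨x, hx, h1, h2⟩, hY⟩ := hZ.eq_integral t
  refine ⟨hermiteConst q H • x, Submodule.smul_mem _ _ hx, ?_, ?_⟩
  · filter_upwards [Lp.coeFn_smul (hermiteConst q H) x.1, h1] with ψ h3 h4
    rw [Prod.smul_fst, h3, Pi.smul_apply, h4, smul_eq_mul]
  · filter_upwards [Lp.coeFn_smul (hermiteConst q H) x.2, h2, hY] with ω h3 h4 h5
    rw [Prod.smul_snd, h3, Pi.smul_apply, h4, smul_eq_mul, h5]

lemma IsHermiteProcess.aemeasurable (hZ : IsHermiteProcess P W q H Z) (t : ℝ≥0) :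
    AEMeasurable (Z t) P := by
  obtain ⟨x, -, -, h⟩ := hZ.exists_mem_graph t
  exact (Lp.aestronglyMeasurable x.2).aemeasurable.congr h

lemma IsHermiteProcess.map_fintype_eq (hZ : IsHermiteProcess P W q H Z)
    (hZ' : IsHermiteProcess P' W' q H Z') {ι : Type*} [Fintype ι] (t : ι → ℝ≥0) :
    P.map (fun ω i => Z (t i) ω) = P'.map (fun ω i => Z' (t i) ω) := by
  choose x hx h1 h2 using fun i => hZ.exists_mem_graph (t i)
  choose x' hx' h1' h2' using fun i => hZ'.exists_mem_graph (t i)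
  have e : (fun ω i => (x i).2 ω) =ᵐ[P] fun ω i => Z (t i) ω := by
    filter_upwards [ae_all_iff.2 h2] with ω h using funext h
  have e' : (fun ω i => (x' i).2 ω) =ᵐ[P'] fun ω i => Z' (t i) ω := by
    filter_upwards [ae_all_iff.2 h2'] with ω h using funext h
  rw [← Measure.map_congr e, ← Measure.map_congr e']
  exact map_pi_snd_eq_of_fst_eq hZ.brownian hZ'.brownian hx hx'
    fun i => Lp.ext ((h1 i).trans (h1' i).symm)

/-- The law of a Hermite process on countably many times depends only on `q` and `H`. -/
lemma IsHermiteProcess.map_countable_eq (hZ : IsHermiteProcess P W q H Z)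
    (hZ' : IsHermiteProcess P' W' q H Z') {ι : Type*} [Countable ι] (t : ι → ℝ≥0) :
    P.map (fun ω i => Z (t i) ω) = P'.map (fun ω i => Z' (t i) ω) := by
  have := hZ.brownian.gaussian.isProbabilityMeasure
  have := hZ'.brownian.gaussian.isProbabilityMeasure
  have m : AEMeasurable (fun ω i => Z (t i) ω) P :=
    aemeasurable_pi_lambda _ fun i => hZ.aemeasurable _
  have m' : AEMeasurable (fun ω i => Z' (t i) ω) P' :=
    aemeasurable_pi_lambda _ fun i => hZ'.aemeasurable _
  -- Both laws are projective limits of the same finite-dimensional marginals, and such a limit is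
  -- unique.
  have l := isProjectiveLimit_map (X := fun i => Z (t i)) m
  have l' := isProjectiveLimit_map (X := fun i => Z' (t i)) m'
  have e : (fun I : Finset ι => P.map (fun ω => I.restrict (fun i => Z (t i) ω)))
      = fun I : Finset ι => P'.map (fun ω => I.restrict (fun i => Z' (t i) ω)) :=
    funext fun I => hZ.map_fintype_eq hZ' (fun i : I => t i)
  rw [e] at l
  exact l.unique l'

lemma IsHermiteProcess.identDistrib_runningSup (hZ : IsHermiteProcess P W q H Z)
    (hZ' : IsHermiteProcess P' W' q H Z') (hc : ∀ᵐ ω ∂P, Continuous fun t => Z t ω)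
    (hc' : ∀ᵐ ω ∂P', Continuous fun t => Z' t ω) (T : ℝ≥0) :
    IdentDistrib (runningSup Z T) (runningSup Z' T) P P' := by
  obtain ⟨S, hS, hd⟩ := TopologicalSpace.exists_countable_dense (Set.Icc 0 T)
  have := hS.to_subtype
  have hm : Measurable fun w : S → ℝ => ⨆ s, |w s| :=
    Measurable.iSup fun s => (measurable_pi_apply s).abs
  have h : IdentDistrib (fun ω (s : S) => Z s ω) (fun ω (s : S) => Z' s ω) P P' :=
    ⟨aemeasurable_pi_lambda _ fun _ => hZ.aemeasurable _,
      aemeasurable_pi_lambda _ fun _ => hZ'.aemeasurable _,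
      hZ.map_countable_eq hZ' fun s : S => ((s : Set.Icc 0 T) : ℝ≥0)⟩
  have e : (fun ω => ⨆ s : S, |Z s ω|) =ᵐ[P] runningSup Z T := by
    filter_upwards [hc] with ω hω using (runningSup_eq_iSup_dense hd hω).symm
  have e' : (fun ω => ⨆ s : S, |Z' s ω|) =ᵐ[P'] runningSup Z' T := by
    filter_upwards [hc'] with ω hω using (runningSup_eq_iSup_dense hd hω).symm
  have h' := h.comp hm
  exact ((IdentDistrib.of_ae_eq h'.aemeasurable_fst e).symm.trans h').trans
    (IdentDistrib.of_ae_eq h'.aemeasurable_snd e')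

end RunningSupLaw

/-! ### Dilations of L² -/

section Dilation

open Module

variable {E : Type*} [NormedAddCommGroup E] [NormedSpace ℝ E] [MeasurableSpace E] [BorelSpace E]
  [FiniteDimensional ℝ E] (μ : Measure E) [μ.IsAddHaarMeasure]

lemma quasiMeasurePreserving_smul_addHaar {r : ℝ} (hr : r ≠ 0) :
    Measure.QuasiMeasurePreserving (fun x : E => r • x) μ μ := by
  refine ⟨by fun_prop, ?_⟩
  rw [Measure.map_addHaar_smul μ hr]
  exact Measure.smul_absolutelyContinuous

/-- Dilations `f ↦ k f(r ·)` are isometries of `L²` if `k² = r ^ dim E`. -/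
lemma exists_dilation_linearIsometry {r k : ℝ} (hr : 0 < r) (hk : k ^ 2 = r ^ finrank ℝ E) :
    ∃ D : Lp ℝ 2 μ →ₗᵢ[ℝ] Lp ℝ 2 μ, ∀ f, D f =ᵐ[μ] fun x => k * f (r • x) := by
  have hq := quasiMeasurePreserving_smul_addHaar μ hr.ne'
  have hm : ∀ f : Lp ℝ 2 μ, MemLp (fun x => k * f (r • x)) 2 μ := fun f => by
    refine MemLp.const_mul (MemLp.comp_of_map (g := f) (f := fun x : E => r • x) ?_
      (by fun_prop)) k
    rw [Measure.map_addHaar_smul μ hr.ne']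
    exact (Lp.memLp f).smul_measure ENNReal.ofReal_ne_top
  have hcoe : ∀ f, (hm f).toLp _ =ᵐ[μ] fun x => k * f (r • x) := fun f => (hm f).coeFn_toLp
  let L : Lp ℝ 2 μ →ₗ[ℝ] Lp ℝ 2 μ :=
    { toFun := fun f => (hm f).toLp _
      map_add' := fun f g => by
        refine Lp.ext ?_
        filter_upwards [hcoe (f + g), hcoe f, hcoe g, hq.ae (Lp.coeFn_add f g),
          Lp.coeFn_add ((hm f).toLp _) ((hm g).toLp _)] with x h1 h2 h3 h4 h5
        rw [h5, Pi.add_apply, h1, h2, h3, h4, Pi.add_apply, mul_add]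
      map_smul' := fun a f => by
        refine Lp.ext ?_
        filter_upwards [hcoe (a • f), hcoe f, hq.ae (Lp.coeFn_smul a f),
          Lp.coeFn_smul a ((hm f).toLp _)] with x h1 h2 h3 h4
        rw [RingHom.id_apply, h4, Pi.smul_apply, h1, h2, h3, Pi.smul_apply, smul_eq_mul,
          smul_eq_mul, mul_left_comm] }
  refine ⟨⟨L, fun f => ?_⟩, hcoe⟩
  have h : ‖L f‖ ^ 2 = ‖f‖ ^ 2 := by
    rw [← real_inner_self_eq_norm_sq, ← real_inner_self_eq_norm_sq, L2.inner_def, L2.inner_def]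
    have e : ∀ᵐ x ∂μ, inner ℝ ((L f) x) ((L f) x)
        = k ^ 2 * (fun y => (inner ℝ (f y) (f y) : ℝ)) (r • x) := by
      filter_upwards [hcoe f] with x hx
      have : (L f) x = k * f (r • x) := hx
      rw [this, real_inner_self_eq_norm_sq, real_inner_self_eq_norm_sq, norm_mul, mul_pow,
        Real.norm_eq_abs k, sq_abs]
    rw [integral_congr_ae e, integral_const_mul,
      Measure.integral_comp_smul μ (fun y => (inner ℝ (f y) (f y) : ℝ)) r, smul_eq_mul,
      abs_of_nonneg (by positivity), hk, mul_inv_cancel_left₀ (by positivity)]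
  exact (sq_eq_sq₀ (norm_nonneg _) (norm_nonneg _)).1 h

end Dilation

/-! ### Self-similarity -/

open scoped Pointwise in
lemma runningSup_scaling {Ω : Type*} (Z : ℝ≥0 → Ω → ℝ) {a : ℝ} (ha : 0 < a) (T : ℝ≥0) (ω : Ω) :
    runningSup Z T ω = a * runningSup (fun t ω => a⁻¹ * Z (T * t) ω) 1 ω := by
  rw [runningSup, runningSup, ← smul_eq_mul, ← Real.sSup_smul_of_nonneg ha.le, ← Set.image_smul,
    Set.image_image]
  have e : Set.Icc 0 T = (fun t => T * t) '' Set.Icc (0 : ℝ≥0) 1 := by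
    rw [Set.image_mul_left_Icc zero_le zero_le_one, mul_zero, mul_one]
  rw [e, Set.image_image]
  simp [abs_mul, abs_of_pos ha, mul_inv_cancel_left₀ ha.ne']

section Scaling

variable {Ω : Type*} [MeasurableSpace Ω] {P : Measure Ω} {W : L2R → Ω → ℝ} {q : ℕ} {H : ℝ}
  {Z : ℝ≥0 → Ω → ℝ}

lemma IsBrownianField.comp_linearIsometry (hW : IsBrownianField P W) (U : L2R →ₗᵢ[ℝ] L2R) :
    IsBrownianField P (fun h => W (U h)) where
  gaussian := hW.gaussian.comp_right U
  centered h := hW.centered _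
  covariance g h := by rw [hW.covariance, U.inner_map_map]

lemma posPow_mul {c : ℝ} (hc : 0 < c) (x a : ℝ) : posPow (c * x) a = c ^ a * posPow x a := by
  unfold posPow
  by_cases hx : 0 < x
  · rw [if_pos (mul_pos hc hx), if_pos hx, Real.mul_rpow hc.le hx.le]
  · rw [if_neg (by rwa [mul_pos_iff_of_pos_left hc]), if_neg hx, mul_zero]

lemma hermiteKernel_scaling {c : ℝ} (hc : 0 < c) (t : ℝ) (ψ : Fin q → ℝ) :
    hermiteKernel q H (c * t) (c • ψ)
      = c * (c ^ (hermiteH0 q H - 3 / 2)) ^ q * hermiteKernel q H t ψ := by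
  unfold hermiteKernel
  have h := intervalIntegral.mul_integral_comp_mul_left (a := 0) (b := t) (c := c)
    (f := fun s => ∏ j, posPow (s - (c • ψ) j) (hermiteH0 q H - 3 / 2))
  rw [mul_zero] at h
  rw [← h]
  simp only [Pi.smul_apply, smul_eq_mul, ← mul_sub, posPow_mul hc, Finset.prod_mul_distrib,
    Finset.prod_const, Finset.card_univ, Fintype.card_fin, intervalIntegral.integral_const_mul,
    mul_assoc]

/-- The exponents add up: q/2 + 1 + q(H_0 - 3/2) = H, since q(H_0 - 1) = H - 1. -/
lemma scaling_exponent {c : ℝ} (hc : 0 < c) (hq : 1 ≤ q) :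
    √c ^ q * (c * (c ^ (hermiteH0 q H - 3 / 2)) ^ q) = c ^ H := by
  have hq' : (q : ℝ) ≠ 0 := by positivity
  rw [Real.sqrt_eq_rpow, ← Real.rpow_mul_natCast hc.le, ← Real.rpow_mul_natCast hc.le]
  nth_rw 2 [← Real.rpow_one c]
  rw [← Real.rpow_add hc, ← Real.rpow_add hc, hermiteH0]
  congr 1
  field_simp
  ring

/-- The new field is W'(h) = W(Uh) with Uh = c^{-1/2} h(·/c). With V the inverse dilation, W'(Vh) =
W(h), so the same random variable is an integral over W' of the dilated kernel. -/
lemma exists_brownianField_scaling (hW : IsBrownianField P W) {c : ℝ} (hc : 0 < c) (q : ℕ) :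
    ∃ W' : L2R → Ω → ℝ, IsBrownianField P W' ∧ ∀ x ∈ multipleWienerGraph P W q,
      ∃ y : Lp ℝ 2 (volume : Measure (Fin q → ℝ)), (y, x.2) ∈ multipleWienerGraph P W' q ∧
        y =ᵐ[volume] fun ψ => √c ^ q * x.1 (c • ψ) := by
  obtain ⟨U, hU⟩ := exists_dilation_linearIsometry (volume : Measure ℝ) (r := c⁻¹) (k := √c⁻¹)
    (inv_pos.2 hc) (by rw [Real.sq_sqrt (inv_nonneg.2 hc.le)]; simp)
  obtain ⟨V, hV⟩ := exists_dilation_linearIsometry (volume : Measure ℝ) (r := c) (k := √c)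
    hc (by simp [Real.sq_sqrt hc.le])
  obtain ⟨D, hD⟩ := exists_dilation_linearIsometry (volume : Measure (Fin q → ℝ)) (r := c)
    (k := √c ^ q) hc (by rw [← pow_mul, mul_comm, pow_mul, Real.sq_sqrt hc.le]; simp)
  have hUV : ∀ h, U (V h) = h := fun h => by
    refine Lp.ext ?_
    filter_upwards [hU (V h),
      (quasiMeasurePreserving_smul_addHaar volume (inv_pos.2 hc).ne').ae (hV h)] with x h1 h2
    rw [h1, h2, smul_smul, mul_inv_cancel₀ hc.ne', one_smul, ← mul_assoc, ← Real.sqrt_mul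
      (inv_nonneg.2 hc.le), inv_mul_cancel₀ hc.ne', Real.sqrt_one, one_mul]
  refine ⟨fun h => W (U h), hW.comp_linearIsometry U, fun x hx => ⟨D x.1, ?_, hD x.1⟩⟩
  -- Φ dilates the kernel and fixes the random variable. It sends generators for W to generators for
  -- W', hence by continuity one closed span into the other.
  let Φ : (Lp ℝ 2 (volume : Measure (Fin q → ℝ)) × Lp ℝ 2 P) →L[ℝ]
      (Lp ℝ 2 (volume : Measure (Fin q → ℝ)) × Lp ℝ 2 P) :=
    D.toContinuousLinearMap.prodMap (ContinuousLinearMap.id ℝ _)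
  have hle : multipleWienerGraph P W q ≤
      (multipleWienerGraph P (fun h => W (U h)) q).comap Φ.toLinearMap := by
    refine Submodule.topologicalClosure_minimal _ (Submodule.span_le.2 ?_)
      ((Submodule.isClosed_topologicalClosure _).preimage Φ.continuous)
    rintro x ⟨h, hh, h1, h2⟩
    refine Submodule.le_topologicalClosure _ (Submodule.subset_span
      ⟨V h, by rw [V.norm_map, hh], ?_, ?_⟩)
    · have hVj : ∀ᵐ ψ : Fin q → ℝ, ∀ j, (V h) (ψ j) = √c * h (c • ψ j) :=
        ae_all_iff.2 fun j => 
          (Measure.quasiMeasurePreserving_eval (fun _ : Fin q => (volume : Measure ℝ)) j).ae (hV h)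
      filter_upwards [hD x.1, (quasiMeasurePreserving_smul_addHaar volume hc.ne').ae h1, hVj]
        with ψ h3 h4 h5
      change (D x.1) ψ = _
      rw [h3, h4]
      simp [h5, Finset.prod_mul_distrib]
    · simp only [hUV]
      exact h2
  exact hle hx

/-- Self-similarity: `t ↦ c^{-H} Z_{ct}` is again a Hermite process, for another field. -/
lemma IsHermiteProcess.exists_scaling (hZ : IsHermiteProcess P W q H Z) (hq : 1 ≤ q) {c : ℝ≥0}
    (hc : 0 < c) :
    ∃ W' : L2R → Ω → ℝ, IsHermiteProcess P W' q H (fun t ω => ((c : ℝ) ^ H)⁻¹ * Z (c * t) ω) := by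
  have hc' : (0 : ℝ) < c := hc
  have hcH : (c : ℝ) ^ H ≠ 0 := (Real.rpow_pos_of_pos hc' H).ne'
  obtain ⟨W', hW', h⟩ := exists_brownianField_scaling hZ.brownian hc' q
  refine ⟨W', hW', fun t => ?_⟩
  obtain ⟨Y, ⟨x, hx, h1, h2⟩, hY⟩ := hZ.eq_integral (c * t)
  obtain ⟨y, hy, h3⟩ := h x hx
  refine ⟨fun ω => ((c : ℝ) ^ H)⁻¹ * Y ω, ⟨((c : ℝ) ^ H)⁻¹ • (y, x.2),
    Submodule.smul_mem _ _ hy, ?_, ?_⟩, ?_⟩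
  · filter_upwards [Lp.coeFn_smul ((c : ℝ) ^ H)⁻¹ y, h3,
      (quasiMeasurePreserving_smul_addHaar volume hc'.ne').ae h1] with ψ h4 h5 h6
    rw [Prod.smul_mk, h4, Pi.smul_apply, h5, h6, NNReal.coe_mul, hermiteKernel_scaling hc',
      ← mul_assoc (√(c : ℝ) ^ q), scaling_exponent hc' hq, smul_eq_mul, inv_mul_cancel_left₀ hcH]
  · filter_upwards [Lp.coeFn_smul ((c : ℝ) ^ H)⁻¹ x.2, h2] with ω h4 h5
    rw [Prod.smul_mk, h4, Pi.smul_apply, h5, smul_eq_mul]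
  · filter_upwards [hY] with ω h4
    rw [h4, mul_left_comm]

end Scaling

/-! ### Moments of the running supremum -/

lemma runningSup_nonneg {Ω : Type*} (Z : ℝ≥0 → Ω → ℝ) (T : ℝ≥0) (ω : Ω) : 0 ≤ runningSup Z T ω :=
  Real.sSup_nonneg (by rintro _ ⟨s, -, rfl⟩; exact abs_nonneg _)

section MaximalMoments

universe u

variable {Ω : Type u} [MeasurableSpace Ω] {P : Measure Ω} {W : L2R → Ω → ℝ} {q : ℕ} {H : ℝ}
  {Z : ℝ≥0 → Ω → ℝ}

/-- Uniqueness in law compares the rescaled process with Z itself, over two different fields on the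
same space. -/
lemma IsHermiteProcess.identDistrib_scaling (hZ : IsHermiteProcess P W q H Z)
    (hc : ∀ᵐ ω ∂P, Continuous fun t => Z t ω) (hq : 1 ≤ q) {T : ℝ≥0} (hT : 0 < T) :
    IdentDistrib (runningSup Z T) (fun ω => (T : ℝ) ^ H * runningSup Z 1 ω) P P := by
  obtain ⟨W', hZ'⟩ := hZ.exists_scaling hq hT
  have hc' : ∀ᵐ ω ∂P, Continuous fun t => ((T : ℝ) ^ H)⁻¹ * Z (T * t) ω := by
    filter_upwards [hc] with ω hω
    exact continuous_const.mul (hω.comp (by fun_prop))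
  have h := (hZ'.identDistrib_runningSup hZ hc' hc 1).comp (measurable_const_mul ((T : ℝ) ^ H))
  have hTH : 0 < (T : ℝ) ^ H := Real.rpow_pos_of_pos hT H
  have e : runningSup Z T = fun ω => (T : ℝ) ^ H *
      runningSup (fun t ω => ((T : ℝ) ^ H)⁻¹ * Z (T * t) ω) 1 ω :=
    funext fun ω => runningSup_scaling Z hTH T ω
  rw [e]
  exact h

lemma IsHermiteProcess.moment_scaling (hZ : IsHermiteProcess P W q H Z)
    (hc : ∀ᵐ ω ∂P, Continuous fun t => Z t ω) (hq : 1 ≤ q) {p : ℝ}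
    (hint : Integrable (fun ω => runningSup Z 1 ω ^ p) P) {T : ℝ≥0} (hT : 0 < T) :
    Integrable (fun ω => runningSup Z T ω ^ p) P ∧
      ∫ ω, runningSup Z T ω ^ p ∂P = (∫ ω, runningSup Z 1 ω ^ p ∂P) * (T : ℝ) ^ (p * H) := by
  have h := (hZ.identDistrib_scaling hc hq hT).comp (u := fun x : ℝ => x ^ p) (by fun_prop)
  have e : ((fun x : ℝ => x ^ p) ∘ fun ω => (T : ℝ) ^ H * runningSup Z 1 ω)
      = fun ω => (T : ℝ) ^ (p * H) * runningSup Z 1 ω ^ p := funext fun ω => by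
    rw [Function.comp_apply, Real.mul_rpow (by positivity) (runningSup_nonneg Z 1 ω),
      ← Real.rpow_mul T.coe_nonneg, mul_comm H p]
  rw [e] at h
  refine ⟨h.integrable_iff.2 (hint.const_mul _), ?_⟩
  have := h.integral_eq
  rw [integral_const_mul, mul_comm] at this
  exact this

/-- The values taken by `E[(Z_1^*)^p]` over all continuous Hermite processes. -/
def runningSupMoments (p : ℝ) (q : ℕ) (H : ℝ) : Set ℝ :=
  {m | ∃ (Ω : Type u) (_ : MeasurableSpace Ω) (P : Measure Ω) (W : L2R → Ω → ℝ)
    (Z : ℝ≥0 → Ω → ℝ), IsHermiteProcess P W q H Z ∧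
      (∀ᵐ ω ∂P, Continuous fun t : ℝ≥0 => Z t ω) ∧ m = ∫ ω, runningSup Z 1 ω ^ p ∂P}

/-- Identically distributed suprema have equal integrals even without integrability, both being 0 in
that case. -/
lemma runningSupMoments_subsingleton (p : ℝ) (q : ℕ) (H : ℝ) :
    (runningSupMoments.{u} p q H).Subsingleton := by
  rintro _ ⟨Ω, _, P, W, Z, hZ, hc, rfl⟩ _ ⟨Ω', _, P', W', Z', hZ', hc', rfl⟩
  exact ((hZ.identDistrib_runningSup hZ' hc hc' 1).comp
    (u := fun x : ℝ => x ^ p) (by fun_prop)).integral_eq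

end MaximalMoments

theorem theorem3p1 :
    ∃ K : ℝ → ℕ → ℝ → ℝ,
      ∀ (p : ℝ) (_ : 0 < p) (q : ℕ) (_ : 1 ≤ q) (H : ℝ) (_ : 1 / 2 < H) (_ : H < 1)
        (Ω : Type*) [MeasurableSpace Ω] (P : Measure Ω) [IsProbabilityMeasure P]
        (W : L2R → Ω → ℝ) (Z : ℝ≥0 → Ω → ℝ)
        (_ : IsHermiteProcess P W q H Z)
        (_ : ∀ᵐ ω ∂P, Continuous fun t : ℝ≥0 => Z t ω)
        (_ : Integrable (fun ω => runningSup Z 1 ω ^ p) P),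
        K p q H = ∫ ω, runningSup Z 1 ω ^ p ∂P ∧
        ∀ (T : ℝ≥0) (_ : 0 < T),
          Integrable (fun ω => runningSup Z T ω ^ p) P ∧
          ∫ ω, runningSup Z T ω ^ p ∂P = K p q H * (T : ℝ) ^ (p * H) := by
  classical
  -- K must be fixed before any process is given, so it is chosen from the set of possible moments.
  -- That set has at most one element; the default 0 is never used once a continuous Hermite process
  -- is at hand.
  refine ⟨fun p q H => if h : (runningSupMoments.{u_1} p q H).Nonempty then h.some else 0, ?_⟩
  intro p _ q hq H _ _ Ω _ P _ W Z hZ hc hint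
  have hmem : ∫ ω, runningSup Z 1 ω ^ p ∂P ∈ runningSupMoments p q H :=
    ⟨Ω, _, P, W, Z, hZ, hc, rfl⟩
  have hne : (runningSupMoments p q H).Nonempty := ⟨_, hmem⟩
  have hK : hne.some = ∫ ω, runningSup Z 1 ω ^ p ∂P :=
    runningSupMoments_subsingleton p q H hne.some_mem hmem
  simp only [dif_pos hne, hK, true_and]
  exact fun T hT => hZ.moment_scaling hc hq hint hT
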